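/- For $X\in M_{m,n}(\mathbb C)$ let $S_X(Y)=X\circ Y$ be entrywise (Schur) multiplication by $X$ on $M_{m,n}(\mathbb C)$, and let $\|S_X\|$ be its norm as a linear operator when $M_{m,n}(\mathbb C)$ carries the operator norm of matrices $\mathbb C^n\to\mathbb C^m$ (Euclidean norms). For a matrix $A$ with columns $A_j$ put $\|A\|_c=\max_j\|A_j\|_2$. If $X$ has rank $r$, a Schur factorization of $X$ is a pair $L\in M_{r,m}(\mathbb C)$, $R\in M_{r,n}(\mathbb C)$ with $X=L^*R$ and $\|L\|_c=\|R\|_c=\sqrt{\|S_X\|}$. Let $\mathcal Q_n$ denote the set of positive semidefinite $n\times n$ complex matrices all of whose diagonal entries equal $1$. A finite set $\{\xi_1,\dots,\xi_s\}\subset\mathbb C^k$ is called full if the only $Y\in M_k(\mathbb C)$ with $Y=PYP$ and $\langle Y\xi_j,\xi_j\rangle=0$ for all $j$ is $Y=0$, where $P$ is the orthogonal projection of $\mathbb C^k$ onto $\operatorname{span}\{\xi_1,\dots,\xi_s\}$. Theorem. Let $X\in M_{m,n}(\mathbb C)$ be an extreme point of the convex set $\{Y\in M_{m,n}(\mathbb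 C):\|S_Y\|\le 1\}$ with $\|S_X\|=1$, and let $r$ be the rank of $X$. Then: (i) For every Schur factorization $X=L^*R$, all columns of $L$ and all columns of $R$ are unit vectors. (ii) There is a factorization $X=FVG$, where $F\in M_m(\mathbb C)$ is positive semidefinite of rank $r$ with $F^2\in\mathcal Q_m$, $G\in M_n(\mathbb C)$ is positive semidefinite of rank $r$ with $G^2\in\mathcal Q_n$, and $V\in M_{m,n}(\mathbb C)$ is a partial isometry with initial space the range of $G$ and final space the range of $F$. (iii) For every Schur factorization $X=L^*R$, the set of columns $\{L_1,\dots,L_m,R_1,\dots,R_n\}$ is a full set of vectors in $\mathbb C^r$. (iv) $\operatorname{rank}X\le\sqrt{m+n}$. -/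

import Mathlib

open scoped ComplexOrder

noncomputable section

namespace SchurMult

section Norm

open scoped Matrix.Norms.L2Operator

/-- The Schur multiplier `S_X : Y ↦ X ∘ Y` (entrywise product) on `m × n` complex matrices. -/
def schurMultiplier {m n : ℕ} (X : Matrix (Fin m) (Fin n) ℂ) :
    Matrix (Fin m) (Fin n) ℂ →ₗ[ℂ] Matrix (Fin m) (Fin n) ℂ where
  toFun Y := Matrix.hadamard X Y
  map_add' Y Z := Matrix.hadamard_add X Y Z
  map_smul' c Y := Matrix.hadamard_smul X Y c

/-- The Schur multiplier norm of `X`: the norm of the linear operator `S_X` on the space of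
`m × n` matrices, where that space carries the operator norm (between Euclidean spaces). -/
def schurNorm {m n : ℕ} (X : Matrix (Fin m) (Fin n) ℂ) : ℝ :=
  ‖LinearMap.toContinuousLinearMap (schurMultiplier X)‖

end Norm

/-- The unit ball of the `m × n` Schur multipliers. -/
def schurUnitBall (m n : ℕ) : Set (Matrix (Fin m) (Fin n) ℂ) :=
  {X | schurNorm X ≤ 1}

/-- The `j`-th column of a matrix, as a vector of a Euclidean space. -/
def colVec {k n : ℕ} (X : Matrix (Fin k) (Fin n) ℂ) (j : Fin n) : EuclideanSpace ℂ (Fin k) :=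
  WithLp.toLp 2 (fun i => X i j)

/-- The column norm: the maximum of the Euclidean norms of the columns. -/
def colNorm {k n : ℕ} (X : Matrix (Fin k) (Fin n) ℂ) : ℝ :=
  ⨆ j, ‖colVec X j‖

/-- `(L, R)` is a Schur factorization of the matrix `X` of rank `r`. -/
structure IsSchurFactorization {m n r : ℕ} (X : Matrix (Fin m) (Fin n) ℂ)
    (L : Matrix (Fin r) (Fin m) ℂ) (R : Matrix (Fin r) (Fin n) ℂ) : Prop where
  rank_eq : X.rank = r
  colNorm_left : colNorm L = Real.sqrt (schurNorm X)
  colNorm_right : colNorm R = Real.sqrt (schurNorm X)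
  eq_mul : X = L.conjTranspose * R

/-- The vector functional `Y ↦ ⟨Y ξ, ξ⟩` on matrices, with the inner product linear in its
first variable; Mathlib's inner product is linear in the second one. -/
def vectorFunctional {k : ℕ} (ξ : EuclideanSpace ℂ (Fin k)) (Y : Matrix (Fin k) (Fin k) ℂ) : ℂ :=
  inner ℂ ξ (Matrix.toEuclideanLin Y ξ)

/-- The matrix of the orthogonal projection onto the linear span of `S`. -/
def spanProj {k : ℕ} (S : Set (EuclideanSpace ℂ (Fin k))) : Matrix (Fin k) (Fin k) ℂ :=
  Matrix.toEuclideanLin.symm ((Submodule.span ℂ S).starProjection :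
    EuclideanSpace ℂ (Fin k) →ₗ[ℂ] EuclideanSpace ℂ (Fin k))

/-- A set of vectors is full if the zero matrix is the only matrix `Y` with `Y = P Y P`, `P` the
projection onto the span, on which all the vector functionals of the set vanish. -/
def IsFullSet {k : ℕ} (S : Set (EuclideanSpace ℂ (Fin k))) : Prop :=
  ∀ Y : Matrix (Fin k) (Fin k) ℂ, Y = spanProj S * Y * spanProj S →
    (∀ ξ ∈ S, vectorFunctional ξ Y = 0) → Y = 0

/-- The positive `n × n` matrices whose diagonal entries are all `1`. -/
def unitDiagPos (n : ℕ) : Set (Matrix (Fin n) (Fin n) ℂ) :=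
  {A | A.PosSemidef ∧ ∀ i, A i i = 1}

/-- The range of a matrix, in Euclidean space. -/
def matRange {m n : ℕ} (A : Matrix (Fin m) (Fin n) ℂ) : Submodule ℂ (EuclideanSpace ℂ (Fin m)) :=
  LinearMap.range (Matrix.toEuclideanLin A)

/-- `V` is the matrix of a partial isometry with initial space `S` and final space `T`. -/
structure IsPartialIsometryFromOnto {m n : ℕ} (V : Matrix (Fin m) (Fin n) ℂ)
    (S : Submodule ℂ (EuclideanSpace ℂ (Fin n))) (T : Submodule ℂ (EuclideanSpace ℂ (Fin m))) :
    Prop where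
  isometric : ∀ x ∈ S, ‖Matrix.toEuclideanLin V x‖ = ‖x‖
  vanishes : ∀ x ∈ Sᗮ, Matrix.toEuclideanLin V x = 0
  map_eq : S.map (Matrix.toEuclideanLin V) = T

end SchurMult

end

/-!
A matrix `X` has Schur norm at most `1` exactly when Schur multiplication by `X` of the
off-diagonal corners preserves positivity of block matrices with prescribed diagonal. If the
partial matrix with unit diagonal and corner `X` had no positive semidefinite completion, a
hyperplane separating it from the closed cone of positive semidefinite matrices restricted to the
prescribed entries would contradict this; a Gram factorization of a completion writes `X = Lᴴ * R`
with all columns of `L` and `R` in the unit ball. Conversely every such product has Schur norm at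
most `1`. Compressing to the ranges of `R` and of `L` leaves only `rank X` rows.

Extremality is now tested by perturbing such a factorization. A column of `L` shorter than `1` can
be moved in both directions inside the unit ball, so all columns are unit vectors. If a Hermitian
`Y` is annihilated by the vector functionals of all columns, then `Lᴴ * (1 ± t • Y) * R` is again
such a product for small `t`, so `Lᴴ * Y * R = 0` and `Y = 0` when `L` and `R` have full rank.
Hence the `m + n` vector functionals are jointly injective on matrices of size `rank X`, which
gives the rank bound. Polar decomposition of `L` and `R` gives the factorization `F * V * G`.
-/

namespace SchurMult

open Matrix WithLp

section PosSemidefCompletion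

variable {𝕜 : Type*} [RCLike 𝕜] {κ ι ι' : Type*} [Fintype κ]

lemma conjTranspose_mul_apply_eq_inner (A : Matrix κ ι 𝕜) (B : Matrix κ ι' 𝕜) (i : ι) (j : ι') :
    (Aᴴ * B) i j = inner 𝕜 (toLp 2 (A.col i)) (toLp 2 (B.col j)) := by
  rw [EuclideanSpace.inner_toLp_toLp, dotProduct_comm]
  rfl

lemma conjTranspose_mul_self_apply_eq_norm_sq (A : Matrix κ ι 𝕜) (i : ι) :
    (Aᴴ * A) i i = (‖toLp 2 (A.col i)‖ : 𝕜) ^ 2 := by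
  rw [conjTranspose_mul_apply_eq_inner, inner_self_eq_norm_sq_to_K]

lemma continuous_hadamard_const (E : Matrix ι ι' 𝕜) : Continuous (· ⊙ E) :=
  continuous_matrix fun i j => (continuous_id.matrix_elem i j).mul continuous_const

open scoped MatrixOrder in
lemma exists_eq_conjTranspose_mul_self [Fintype ι] {A : Matrix ι ι 𝕜} (hA : A.PosSemidef) :
    ∃ C : Matrix ι ι 𝕜, A = Cᴴ * C := by
  classical
  exact CStarAlgebra.nonneg_iff_eq_star_mul_self.1 (nonneg_iff_posSemidef.2 hA)

lemma norm_apply_sq_le_of_posSemidef [Finite ι] {A : Matrix ι ι 𝕜} (hA : A.PosSemidef) (i j : ι) :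
    ‖A i j‖ ^ 2 ≤ ‖A i i‖ * ‖A j j‖ := by
  cases nonempty_fintype ι
  obtain ⟨C, rfl⟩ := exists_eq_conjTranspose_mul_self hA
  simp only [conjTranspose_mul_self_apply_eq_norm_sq, conjTranspose_mul_apply_eq_inner, norm_pow,
    RCLike.norm_ofReal, abs_norm, ← mul_pow]
  gcongr
  exact norm_inner_le_norm _ _

lemma isClosed_setOf_posSemidef [Finite ι] : IsClosed {A : Matrix ι ι 𝕜 | A.PosSemidef} := by
  cases nonempty_fintype ι
  simp only [posSemidef_iff_dotProduct_mulVec, IsHermitian, Set.ofPred_and, Set.ofPred_forall]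
  refine (isClosed_eq (by fun_prop) continuous_id).inter (isClosed_iInter fun x => ?_)
  exact isClosed_Ici.preimage (by fun_prop)

lemma isClosed_image_of_norm_le {E F : Type*} [NormedAddCommGroup E] [ProperSpace E]
    [NormedAddCommGroup F] [ProperSpace F] {f : E → F} (hf : Continuous f) {s : Set E}
    (hs : IsClosed s) (h : ∀ x ∈ s, ‖x‖ ≤ ‖f x‖) : IsClosed (f '' s) := by
  have hproper : IsProperMap fun x : s => f x := by
    refine isProperMap_iff_tendsto_cocompact.2 ⟨by fun_prop, ?_⟩
    rw [← Metric.cobounded_eq_cocompact (α := F), ← tendsto_norm_atTop_iff_cobounded]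
    exact Filter.tendsto_atTop_mono (fun x => h x x.2)
      (tendsto_norm_cocompact_atTop.comp hs.isClosedEmbedding_subtypeVal.tendsto_cocompact)
  rw [Set.image_eq_range]
  exact hproper.isClosedMap.isClosed_range

open scoped Matrix.Norms.Elementwise in
lemma isClosed_image_hadamard_posSemidef [Finite ι] {E : Matrix ι ι 𝕜} (hE : ∀ i, E i i = 1) :
    IsClosed ((· ⊙ E) '' {A : Matrix ι ι 𝕜 | A.PosSemidef}) := by
  cases nonempty_fintype ι
  refine isClosed_image_of_norm_le (continuous_hadamard_const E) isClosed_setOf_posSemidef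
    fun A hA => ?_
  refine (norm_le_iff (norm_nonneg _)).2 fun i j => abs_le_of_sq_le_sq' ?_ (norm_nonneg _) |>.2
  have hdiag (k : ι) : ‖A k k‖ ≤ ‖A ⊙ E‖ := by
    simpa [hE] using norm_entry_le_entrywise_sup_norm (A ⊙ E) (i := k) (j := k)
  rw [sq ‖A ⊙ E‖]
  exact (norm_apply_sq_le_of_posSemidef hA i j).trans (by gcongr <;> apply hdiag)

lemma exists_isHermitian_forall_eq_sum_hadamard [Fintype ι] (f : StrongDual ℝ (Matrix ι ι 𝕜)) :
    ∃ H : Matrix ι ι 𝕜, H.IsHermitian ∧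
      ∀ Z, Z.IsHermitian → (f Z : 𝕜) = ∑ i, ∑ j, (H ⊙ Z) i j := by
  classical
  set G : Matrix ι ι 𝕜 := of fun i j => f.extendRCLike (𝕜 := 𝕜) (single i j 1) with hG
  have hF (Z : Matrix ι ι 𝕜) : f.extendRCLike (𝕜 := 𝕜) Z = ∑ i, ∑ j, (G ⊙ Z) i j := by
    conv_lhs => rw [matrix_eq_sum_single Z]
    simp only [map_sum, hadamard_apply, hG, of_apply]
    congr! 2 with i _ j
    rw [mul_comm, ← smul_eq_mul, ← map_smul, smul_single, smul_eq_mul, mul_one]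
  refine ⟨(2⁻¹ : ℝ) • (G + Gᴴ), (isHermitian_add_transpose_self G).smul (.all _), fun Z hZ => ?_⟩
  have hre : ((f Z : ℝ) : 𝕜) = RCLike.re (∑ i, ∑ j, (G ⊙ Z) i j) := by
    rw [← hF, StrongDual.re_extendRCLike_apply]
  have hconj : ∑ i, ∑ j, (Gᴴ ⊙ Z) i j = star (∑ i, ∑ j, (G ⊙ Z) i j) := by
    simp only [star_sum, hadamard_apply, conjTranspose_apply, star_mul', hZ.apply]
    exact Finset.sum_comm
  simp only [smul_hadamard, add_hadamard, Matrix.smul_apply, Matrix.add_apply,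
    ← Finset.smul_sum, Finset.sum_add_distrib]
  rw [hre, hconj, RCLike.re_eq_add_conj, RCLike.star_def, RCLike.real_smul_eq_coe_mul]
  push_cast
  ring

open scoped MatrixOrder in
theorem exists_posSemidef_hadamard_eq [Finite ι] {E T : Matrix ι ι 𝕜}
    (hE : E.IsHermitian) (hE1 : ∀ i, E i i = 1) (hT : T.IsHermitian)
    (h : ∀ H : Matrix ι ι 𝕜, H.IsHermitian → (H ⊙ E).PosSemidef → (H ⊙ T).PosSemidef) :
    ∃ A : Matrix ι ι 𝕜, A.PosSemidef ∧ A ⊙ E = T := by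
  cases nonempty_fintype ι
  by_contra! hne
  let K : ProperCone ℝ (Matrix ι ι 𝕜) :=
    { (PointedCone.positive ℝ (Matrix ι ι 𝕜)).map
        { toFun := (· ⊙ E)
          map_add' := fun A B => add_hadamard E A B
          map_smul' := fun c A => smul_hadamard A E c } with
      isClosed' := by
        convert! isClosed_image_hadamard_posSemidef hE1
        ext; simp [nonneg_iff_posSemidef] }
  have : LocallyConvexSpace ℝ (Matrix ι ι 𝕜) :=
    inferInstanceAs (LocallyConvexSpace ℝ (ι → ι → 𝕜))
  obtain ⟨f, hf, hfT⟩ := K.hyperplane_separation_point (x₀ := T) fun ⟨A, hA, hAT⟩ =>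
    hne A (nonneg_iff_posSemidef.1 hA) hAT
  obtain ⟨H, hH, hfH⟩ := exists_isHermitian_forall_eq_sum_hadamard f
  have hquad (B : Matrix ι ι 𝕜) (x : ι → 𝕜) : star x ⬝ᵥ (H ⊙ B) *ᵥ x =
      ∑ i, ∑ j, (H ⊙ (vecMulVec (star x) x ⊙ B)) i j := by
    simp only [dotProduct, mulVec, hadamard_apply, vecMulVec_apply, Finset.mul_sum]
    congr! 2
    ring
  -- Nonnegativity of `f` on the matrices `x xᴴ ⊙ E` says that `H ⊙ E` is positive semidefinite.
  have hHE : (H ⊙ E).PosSemidef := by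
    refine .of_dotProduct_mulVec_nonneg (hH.hadamard hE) fun x => ?_
    have hx := posSemidef_vecMulVec_star_self x
    rw [hquad, ← hfH _ (hx.isHermitian.hadamard hE), RCLike.ofReal_nonneg]
    exact hf _ ⟨_, nonneg_iff_posSemidef.2 hx, rfl⟩
  -- The quadratic form of `H ⊙ T` at the all-ones vector is `f T`, which is negative.
  have hT0 := (h H hH hHE).dotProduct_mulVec_nonneg 1
  have h1 : vecMulVec (star 1) 1 ⊙ T = T := by ext; simp
  rw [hquad, h1, ← hfH T hT, RCLike.ofReal_nonneg] at hT0
  exact hT0.not_gt hfT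

end PosSemidefCompletion

section WeightedBlock

variable {m n : Type*} [DecidableEq m] [DecidableEq n] {p p' : m → ℝ} {q q' : n → ℝ}
  {B : Matrix m n ℂ}

/-- The self-adjoint block matrix with corner `B` and diagonal blocks the diagonal matrices with
real entries `p` and `q`. For `p = q = 1` it is positive semidefinite exactly when `B` is a
contraction, which turns operator norm bounds into positivity. -/
def weightedBlock (p : m → ℝ) (B : Matrix m n ℂ) (q : n → ℝ) : Matrix (m ⊕ n) (m ⊕ n) ℂ :=
  fromBlocks (diagonal fun i => (p i : ℂ)) B Bᴴ (diagonal fun j => (q j : ℂ))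

lemma isHermitian_weightedBlock (p : m → ℝ) (B : Matrix m n ℂ) (q : n → ℝ) :
    (weightedBlock p B q).IsHermitian :=
  .fromBlocks (isHermitian_diagonal_of_self_adjoint _ (by ext; simp)) rfl
    (isHermitian_diagonal_of_self_adjoint _ (by ext; simp))

lemma posSemidef_weightedBlock_mono (h : (weightedBlock p B q).PosSemidef)
    (hp : p ≤ p') (hq : q ≤ q') : (weightedBlock p' B q').PosSemidef := by
  have hadd : weightedBlock p' B q' = weightedBlock p B q +
      diagonal (Sum.elim (fun i => (↑(p' i - p i) : ℂ)) fun j => ↑(q' j - q j)) := by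
    simp [weightedBlock, ← fromBlocks_diagonal, fromBlocks_add]
  rw [hadd]
  refine h.add (.diagonal ?_)
  rintro (i | j) <;> simp [hp _, hq _]

lemma posSemidef_weightedBlock_scale [Finite m] [Finite n]
    (h : (weightedBlock p B q).PosSemidef) (a : m → ℝ) (b : n → ℝ) :
    (weightedBlock (a ^ 2 * p) (of fun i j => a i * B i j * b j) (b ^ 2 * q)).PosSemidef := by
  cases nonempty_fintype m
  cases nonempty_fintype n
  have hD := h.mul_mul_conjTranspose_same (diagonal (Sum.elim (fun i => (a i : ℂ)) fun j => ↑(b j)))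
  convert! hD using 1
  ext (i | i) (j | j)
  · rcases eq_or_ne i j with rfl | hij
    · simp [weightedBlock, sq, mul_right_comm]
    · simp [weightedBlock, hij]
  · simp [weightedBlock]
  · simp [weightedBlock, mul_comm, mul_assoc, mul_left_comm]
  · rcases eq_or_ne i j with rfl | hij
    · simp [weightedBlock, sq, mul_right_comm]
    · simp [weightedBlock, hij]

open scoped MatrixOrder Matrix.Norms.L2Operator in
lemma posSemidef_weightedBlock_one_iff [Fintype m] [Fintype n] :
    (weightedBlock 1 B 1).PosSemidef ↔ ‖B‖ ≤ 1 := by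
  have hblock : weightedBlock 1 B 1 = fromBlocks 1 B Bᴴ 1 := by simp [weightedBlock]
  let : Invertible (1 : Matrix m m ℂ) := invertibleOne
  rw [hblock, PosDef.fromBlocks₁₁ B 1 .one, inv_one, Matrix.mul_one, ← le_iff,
    ← CStarAlgebra.norm_le_one_iff_of_nonneg _
      (nonneg_iff_posSemidef.2 (posSemidef_conjTranspose_mul_self B)),
    l2_opNorm_conjTranspose_mul_self, ← sq, sq_le_one_iff₀ (norm_nonneg B)]

lemma weightedBlock_one_apply_self (B : Matrix m n ℂ) (s : m ⊕ n) :
    weightedBlock 1 B 1 s s = 1 := by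
  rcases s with i | j <;> simp [weightedBlock]

lemma hadamard_weightedBlock_one {H : Matrix (m ⊕ n) (m ⊕ n) ℂ} (hH : H.IsHermitian)
    (B : Matrix m n ℂ) : H ⊙ weightedBlock 1 B 1 = weightedBlock
      (fun i => (H (.inl i) (.inl i)).re) (B ⊙ H.toBlocks₁₂) fun j => (H (.inr j) (.inr j)).re := by
  ext (i | i) (j | j)
  · rcases eq_or_ne i j with rfl | hij
    · simpa [weightedBlock] using (hH.coe_re_apply_self _).symm
    · simp [weightedBlock, hij]
  · simp [weightedBlock, toBlocks₁₂, mul_comm]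
  · simp [weightedBlock, toBlocks₁₂, ← hH.apply (.inr i) (.inl j), mul_comm]
  · rcases eq_or_ne i j with rfl | hij
    · simpa [weightedBlock] using (hH.coe_re_apply_self _).symm
    · simp [weightedBlock, hij]

end WeightedBlock

section SchurNormLeOne

variable {m n : ℕ} {X : Matrix (Fin m) (Fin n) ℂ}

open scoped Matrix.Norms.L2Operator in
lemma schurNorm_le_one_iff : schurNorm X ≤ 1 ↔ ∀ Y, (weightedBlock 1 Y 1).PosSemidef →
    (weightedBlock 1 (X ⊙ Y) 1).PosSemidef := by
  simp only [posSemidef_weightedBlock_one_iff]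
  refine ⟨fun h Y hY => ?_, fun h => ?_⟩
  · exact ((schurMultiplier X).toContinuousLinearMap.le_of_opNorm_le h Y).trans (by simpa)
  · exact ContinuousLinearMap.opNorm_le_of_unit_norm zero_le_one fun Y hY => h Y hY.le

lemma posSemidef_weightedBlock_hadamard (hX : schurNorm X ≤ 1) {p : Fin m → ℝ} {q : Fin n → ℝ}
    {B : Matrix (Fin m) (Fin n) ℂ} (hB : (weightedBlock p B q).PosSemidef) :
    (weightedBlock p (X ⊙ B) q).PosSemidef := by
  have hp (i) : 0 ≤ p i := by simpa [weightedBlock] using hB.diag_nonneg (i := .inl i)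
  have hq (j) : 0 ≤ q j := by simpa [weightedBlock] using hB.diag_nonneg (i := .inr j)
  have hle (t : ℝ) (ht : 0 ≤ t) : (√t)⁻¹ ^ 2 * t ≤ 1 := by
    rw [inv_pow, Real.sq_sqrt ht]
    exact inv_mul_le_one
  have hunit := posSemidef_weightedBlock_mono
    (posSemidef_weightedBlock_scale hB (fun i => (√(p i))⁻¹) (fun j => (√(q j))⁻¹))
    (p' := 1) (q' := 1) (fun i => hle _ (hp i)) (fun j => hle _ (hq j))
  convert! posSemidef_weightedBlock_scale (schurNorm_le_one_iff.1 hX _ hunit)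
    (fun i => √(p i)) (fun j => √(q j)) using 2
  · ext i; simp [hp]
  · ext i j
    have hentry : ‖B i j‖ ^ 2 ≤ (√(p i) * √(q j)) ^ 2 := by
      simpa [weightedBlock, mul_pow, hp, hq, abs_of_nonneg] using
        norm_apply_sq_le_of_posSemidef hB (.inl i) (.inr j)
    by_cases hpq : √(p i) * √(q j) = 0
    · have hB0 : B i j = 0 := by simpa [hpq, sq_nonpos_iff] using hentry
      simp [hB0]
    · obtain ⟨hp0, hq0⟩ := mul_ne_zero_iff.1 hpq
      simp only [hadamard_apply, of_apply]
      push_cast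
      field_simp
  · ext i; simp [hq]

/-- All columns of the matrix lie in the closed Euclidean unit ball. -/
def HasContractiveColumns {κ ι : Type*} [Fintype κ] (L : Matrix κ ι ℂ) : Prop :=
  ∀ i, ‖toLp 2 (L.col i)‖ ≤ 1

theorem schurNorm_conjTranspose_mul_le_one {κ : Type*} [Fintype κ] {L : Matrix κ (Fin m) ℂ}
    {R : Matrix κ (Fin n) ℂ} (hL : HasContractiveColumns L) (hR : HasContractiveColumns R) :
    schurNorm (Lᴴ * R) ≤ 1 := by
  refine schurNorm_le_one_iff.2 fun Y hY => ?_
  have hgram := (posSemidef_conjTranspose_mul_self (fromCols L R)).hadamard hY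
  rw [hadamard_weightedBlock_one (isHermitian_conjTranspose_mul_self _), hadamard_comm,
    conjTranspose_fromCols_eq_fromRows_conjTranspose, fromRows_mul_fromCols,
    toBlocks_fromBlocks₁₂] at hgram
  refine posSemidef_weightedBlock_mono hgram (fun i => ?_) fun j => ?_
  · simpa [conjTranspose_mul_self_apply_eq_norm_sq, ← Complex.ofReal_pow] using hL i
  · simpa [conjTranspose_mul_self_apply_eq_norm_sq, ← Complex.ofReal_pow] using hR j

theorem exists_contractive_factorization_of_schurNorm_le_one (hX : schurNorm X ≤ 1) :
    ∃ (L : Matrix (Fin m ⊕ Fin n) (Fin m) ℂ) (R : Matrix (Fin m ⊕ Fin n) (Fin n) ℂ),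
      HasContractiveColumns L ∧ HasContractiveColumns R ∧ X = Lᴴ * R := by
  obtain ⟨A, hA, hAX⟩ := exists_posSemidef_hadamard_eq
    (isHermitian_weightedBlock 1 (of 1) 1) (T := weightedBlock 1 X 1)
    (weightedBlock_one_apply_self _) (isHermitian_weightedBlock 1 X 1)
    fun H hH hHE => by
      rw [hadamard_weightedBlock_one hH, hadamard_comm, hadamard_of_one] at hHE
      rw [hadamard_weightedBlock_one hH]
      exact posSemidef_weightedBlock_hadamard hX hHE
  obtain ⟨C, rfl⟩ := exists_eq_conjTranspose_mul_self hA
  have hdiag (s) : ‖toLp 2 (C.col s)‖ ≤ 1 := by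
    have hs := congr_fun₂ hAX s s
    rw [hadamard_apply, weightedBlock_one_apply_self, weightedBlock_one_apply_self, mul_one,
      conjTranspose_mul_self_apply_eq_norm_sq] at hs
    exact ((pow_eq_one_iff_of_nonneg (norm_nonneg _) two_ne_zero).1
      (Complex.ofReal_injective (by simpa using hs))).le
  refine ⟨C.submatrix id .inl, C.submatrix id .inr, fun i => hdiag (.inl i),
    fun j => hdiag (.inr j), ?_⟩
  ext i j
  simpa [weightedBlock, mul_apply] using (congr_fun₂ hAX (.inl i) (.inr j)).symm

end SchurNormLeOne

section RankCompression

variable {𝕜 : Type*} [RCLike 𝕜] {κ ι ι' : Type*} [Fintype κ]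

lemma isUnit_mul_conjTranspose_self_of_rank_eq_card [DecidableEq κ] [Fintype ι] {A : Matrix κ ι 𝕜}
    (hA : A.rank = Fintype.card κ) : IsUnit (A * Aᴴ) := by
  rw [← mulVec_surjective_iff_isUnit]
  refine (LinearMap.range_eq_top (f := (A * Aᴴ).mulVecLin)).1 (Submodule.eq_top_of_finrank_eq ?_)
  rw [← rank, rank_self_mul_conjTranspose, hA, Module.finrank_pi]

lemma rank_conjTranspose_mul_of_rank_eq_card [Fintype ι] [Fintype ι'] {R : Matrix κ ι' 𝕜}
    (hR : R.rank = Fintype.card κ) (L : Matrix κ ι 𝕜) : (Lᴴ * R).rank = L.rank := by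
  classical
  have hunit := (isUnit_iff_isUnit_det _).1 (isUnit_mul_conjTranspose_self_of_rank_eq_card hR)
  refine le_antisymm ((rank_mul_le_left _ _).trans_eq (rank_conjTranspose L)) ?_
  calc L.rank = (Lᴴ * R * Rᴴ).rank := by
        rw [Matrix.mul_assoc, rank_mul_eq_left_of_isUnit_det _ _ hunit, rank_conjTranspose]
    _ ≤ (Lᴴ * R).rank := rank_mul_le_left _ _

lemma exists_orthonormal_col_mul_conjTranspose_mul_eq [Fintype ι] (R : Matrix κ ι 𝕜) :
    ∃ J : Matrix κ (Fin R.rank) 𝕜, (Orthonormal 𝕜 fun s => toLp 2 (J.col s)) ∧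
      J * (Jᴴ * R) = R := by
  classical
  set S := LinearMap.range (toEuclideanLin R)
  have hS : Module.finrank 𝕜 S = R.rank := by
    rw [rank_eq_finrank_range_toLin R (EuclideanSpace.basisFun κ 𝕜).toBasis
      (EuclideanSpace.basisFun ι 𝕜).toBasis, ← toEuclideanLin_eq_toLin_orthonormal]
  let b := (stdOrthonormalBasis 𝕜 S).reindex (finCongr hS)
  refine ⟨of fun k s => (b s : EuclideanSpace 𝕜 κ) k,
    b.orthonormal.comp_linearIsometry S.subtypeₗᵢ, ?_⟩
  ext k j
  have hj : toLp 2 (R.col j) ∈ S := ⟨EuclideanSpace.single j 1, by simp [toLpLin_apply]⟩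
  have hexpand := congr(($(b.sum_repr' ⟨_, hj⟩) : EuclideanSpace 𝕜 κ) k)
  simp only [Submodule.coe_sum, Submodule.coe_smul, Submodule.coe_inner, WithLp.ofLp_sum,
    Finset.sum_apply, PiLp.smul_apply, smul_eq_mul] at hexpand
  rw [mul_apply]
  simp only [conjTranspose_mul_apply_eq_inner, mul_comm (of _ k _)]
  exact hexpand

lemma HasContractiveColumns.conjTranspose_mul_of_orthonormal {σ : Type*} [Fintype σ]
    {A : Matrix κ ι ℂ} (hA : HasContractiveColumns A) {J : Matrix κ σ ℂ}
    (hJ : Orthonormal ℂ fun s => toLp 2 (J.col s)) : HasContractiveColumns (Jᴴ * A) := fun i => by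
  refine le_trans ?_ (hA i)
  rw [← sq_le_sq₀ (norm_nonneg _) (norm_nonneg _), EuclideanSpace.norm_sq_eq]
  simpa only [col_apply, conjTranspose_mul_apply_eq_inner] using
    hJ.sum_inner_products_le (toLp 2 (A.col i)) (s := Finset.univ)

theorem exists_contractive_factorization_rank_right [Fintype ι'] {L : Matrix κ ι ℂ}
    {R : Matrix κ ι' ℂ} (hL : HasContractiveColumns L) (hR : HasContractiveColumns R) :
    ∃ (L' : Matrix (Fin R.rank) ι ℂ) (R' : Matrix (Fin R.rank) ι' ℂ),
      HasContractiveColumns L' ∧ HasContractiveColumns R' ∧ R'.rank = R.rank ∧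
        L'ᴴ * R' = Lᴴ * R := by
  obtain ⟨J, hJ, hJR⟩ := exists_orthonormal_col_mul_conjTranspose_mul_eq R
  refine ⟨Jᴴ * L, Jᴴ * R, hL.conjTranspose_mul_of_orthonormal hJ,
    hR.conjTranspose_mul_of_orthonormal hJ, le_antisymm (rank_mul_le_right _ _) ?_, ?_⟩
  · conv_lhs => rw [← hJR]
    exact rank_mul_le_right _ _
  · rw [conjTranspose_mul, conjTranspose_conjTranspose, Matrix.mul_assoc, hJR]

theorem exists_contractive_factorization_of_rank_eq {m n r : ℕ} {X : Matrix (Fin m) (Fin n) ℂ}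
    (hX : schurNorm X ≤ 1) (hr : X.rank = r) :
    ∃ (L : Matrix (Fin r) (Fin m) ℂ) (R : Matrix (Fin r) (Fin n) ℂ),
      HasContractiveColumns L ∧ HasContractiveColumns R ∧ X = Lᴴ * R := by
  obtain ⟨L₀, R₀, hL₀, hR₀, h₀⟩ := exists_contractive_factorization_of_schurNorm_le_one hX
  obtain ⟨L₁, R₁, hL₁, hR₁, hR₁_rank, h₁⟩ := exists_contractive_factorization_rank_right hL₀ hR₀
  obtain ⟨R, L, hR, hL, -, h⟩ := exists_contractive_factorization_rank_right hR₁ hL₁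
  have hrank : L₁.rank = r := by
    rw [← rank_conjTranspose_mul_of_rank_eq_card (by simpa using hR₁_rank) L₁, h₁, ← h₀, hr]
  subst hrank
  refine ⟨L, R, hL, hR, ?_⟩
  rw [h₀, ← h₁, ← conjTranspose_inj, conjTranspose_mul, conjTranspose_mul,
    conjTranspose_conjTranspose, conjTranspose_conjTranspose, h]

end RankCompression

section ExtremePoints

variable {m n r : ℕ} {X : Matrix (Fin m) (Fin n) ℂ}

lemma eq_zero_of_add_mem_of_sub_mem {E : Type*} [AddCommGroup E] [Module ℝ E] {s : Set E} {x d : E}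
    (hx : x ∈ s.extremePoints ℝ) (hadd : x + d ∈ s) (hsub : x - d ∈ s) : d = 0 := by
  refine add_eq_left.1 (hx.2 hadd hsub ⟨2⁻¹, 2⁻¹, by norm_num, by norm_num, by norm_num, ?_⟩)
  module

lemma conjTranspose_mem_schurUnitBall (hX : X ∈ schurUnitBall m n) : Xᴴ ∈ schurUnitBall n m := by
  obtain ⟨L, R, hL, hR, rfl⟩ := exists_contractive_factorization_of_schurNorm_le_one hX
  rw [conjTranspose_mul, conjTranspose_conjTranspose]
  exact schurNorm_conjTranspose_mul_le_one hR hL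

lemma conjTranspose_mem_extremePoints (hX : X ∈ (schurUnitBall m n).extremePoints ℝ) :
    Xᴴ ∈ (schurUnitBall n m).extremePoints ℝ := by
  have himage : (conjTransposeLinearEquiv _ _ ℝ ℂ) '' schurUnitBall m n = schurUnitBall n m := by
    ext Y
    refine ⟨?_, fun hY => ⟨Yᴴ, conjTranspose_mem_schurUnitBall hY, conjTranspose_conjTranspose Y⟩⟩
    rintro ⟨Z, hZ, rfl⟩
    exact conjTranspose_mem_schurUnitBall hZ
  rw [← himage, ← image_extremePoints]
  exact ⟨X, hX, rfl⟩

open scoped Matrix.Norms.L2Operator in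
lemma ne_zero_of_schurNorm_eq_one (hX : schurNorm X = 1) : X ≠ 0 := by
  rintro rfl
  have hzero : schurMultiplier (0 : Matrix (Fin m) (Fin n) ℂ) = 0 :=
    LinearMap.ext fun Y => zero_hadamard Y
  rw [schurNorm, hzero, map_zero] at hX
  exact zero_ne_one (ContinuousLinearMap.opNorm_zero.symm.trans hX)

lemma HasContractiveColumns.add_single {κ ι : Type*} [Fintype κ] [DecidableEq κ] [DecidableEq ι]
    {L : Matrix κ ι ℂ} (hL : HasContractiveColumns L) (k : κ) {i : ι} {c : ℂ}
    (hc : ‖c‖ ≤ 1 - ‖toLp 2 (L.col i)‖) : HasContractiveColumns (L + single k i c) := fun i' => by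
  rcases eq_or_ne i i' with rfl | hne
  · have hcol : toLp 2 ((L + single k i c).col i) =
        toLp 2 (L.col i) + EuclideanSpace.single k c := by
      ext k'
      simp [single_apply, eq_comm]
    rw [hcol]
    exact (norm_add_le _ _).trans (by simpa [← le_sub_iff_add_le'] using hc)
  · have hcol : (L + single k i c).col i' = L.col i' := by
      ext k'
      simp [hne]
    rw [hcol]
    exact hL i'

theorem norm_col_left_eq_one (hext : X ∈ (schurUnitBall m n).extremePoints ℝ) (hX : X ≠ 0)
    {κ : Type*} [Fintype κ] {L : Matrix κ (Fin m) ℂ} {R : Matrix κ (Fin n) ℂ}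
    (hL : HasContractiveColumns L) (hR : HasContractiveColumns R) (h : X = Lᴴ * R) (i : Fin m) :
    ‖toLp 2 (L.col i)‖ = 1 := by
  classical
  refine (hL i).eq_of_not_lt fun hi => hX ?_
  suffices hR0 : R = 0 by rw [h, hR0, Matrix.mul_zero]
  ext k j
  let c : ℂ := ↑(1 - ‖toLp 2 (L.col i)‖)
  have hc : ‖c‖ ≤ 1 - ‖toLp 2 (L.col i)‖ := (Complex.norm_of_nonneg (sub_nonneg.2 hi.le)).le
  have hmem {c' : ℂ} (hc' : ‖c'‖ ≤ 1 - ‖toLp 2 (L.col i)‖) :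
      X + (single k i c')ᴴ * R ∈ schurUnitBall m n := by
    rw [h, ← Matrix.add_mul, ← conjTranspose_add]
    exact schurNorm_conjTranspose_mul_le_one (hL.add_single k hc') hR
  have hneg : single k i (-c) = -single k i c := map_neg (singleAddMonoidHom k i) c
  have hd : (single k i c)ᴴ * R = 0 := eq_zero_of_add_mem_of_sub_mem hext (hmem hc)
    (by simpa [hneg, sub_eq_add_neg] using hmem ((norm_neg c).trans_le hc))
  have hij := congr_fun₂ hd i j
  rw [conjTranspose_single, single_mul_apply_same, Matrix.zero_apply, mul_eq_zero,
    star_eq_zero] at hij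
  exact hij.resolve_left (Complex.ofReal_ne_zero.2 (sub_pos.2 hi).ne')

theorem norm_col_right_eq_one (hext : X ∈ (schurUnitBall m n).extremePoints ℝ) (hX : X ≠ 0)
    {κ : Type*} [Fintype κ] {L : Matrix κ (Fin m) ℂ} {R : Matrix κ (Fin n) ℂ}
    (hL : HasContractiveColumns L) (hR : HasContractiveColumns R) (h : X = Lᴴ * R) (j : Fin n) :
    ‖toLp 2 (R.col j)‖ = 1 :=
  norm_col_left_eq_one (conjTranspose_mem_extremePoints hext)
    (by rwa [Ne, conjTranspose_eq_zero]) hR hL (by simp [h]) j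

open scoped MatrixOrder Matrix.Norms.L2Operator in
lemma exists_posSemidef_one_add_smul_and_one_sub_smul {κ : Type*} [Finite κ] [DecidableEq κ]
    {Y : Matrix κ κ ℂ} (hY : Y.IsHermitian) :
    ∃ t : ℝ, t ≠ 0 ∧ (1 + t • Y).PosSemidef ∧ (1 - t • Y).PosSemidef := by
  cases nonempty_fintype κ
  rcases eq_or_ne Y 0 with rfl | hY0
  · exact ⟨1, one_ne_zero, by simpa using .one, by simpa using .one⟩
  refine ⟨‖Y‖⁻¹, inv_ne_zero (norm_ne_zero_iff.2 hY0), ?_⟩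
  have hscale (Z : Matrix κ κ ℂ) : ‖Y‖⁻¹ • (‖Y‖ • 1 + Z) = 1 + ‖Y‖⁻¹ • Z := by
    rw [smul_add, inv_smul_smul₀ (norm_ne_zero_iff.2 hY0)]
  have hpos {Z : Matrix κ κ ℂ} (hZ : (‖Y‖ • (1 : Matrix κ κ ℂ) + Z).PosSemidef) :
      (1 + ‖Y‖⁻¹ • Z).PosSemidef := hscale Z ▸ hZ.smul (inv_nonneg.2 (norm_nonneg Y))
  have hlow := le_iff.1 (IsSelfAdjoint.neg_algebraMap_norm_le_self (a := Y) hY)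
  have hup := le_iff.1 (IsSelfAdjoint.le_algebraMap_norm_self (a := Y) hY)
  rw [Algebra.algebraMap_eq_smul_one] at hlow hup
  refine ⟨hpos (by simpa [add_comm] using hlow), ?_⟩
  simpa [sub_eq_add_neg] using hpos (Z := -Y) (by simpa [sub_eq_add_neg] using hup)

variable {κ : Type*} [Fintype κ] {L : Matrix κ (Fin m) ℂ} {R : Matrix κ (Fin n) ℂ}

lemma hasContractiveColumns_mul_of_diag_eq_one {ι : Type*} {A C : Matrix κ κ ℂ}
    {B : Matrix κ ι ℂ} (hAC : A = Cᴴ * C) (hB : diag (Bᴴ * A * B) = 1) :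
    HasContractiveColumns (C * B) := fun i => by
  have hgram : (C * B)ᴴ * (C * B) = Bᴴ * A * B := by
    simp only [hAC, conjTranspose_mul, Matrix.mul_assoc]
  have hi := congr_fun hB i
  rw [diag_apply, ← hgram, conjTranspose_mul_self_apply_eq_norm_sq] at hi
  exact ((pow_eq_one_iff_of_nonneg (norm_nonneg _) two_ne_zero).1
    (Complex.ofReal_injective (by simpa using hi))).le

lemma conjTranspose_mul_mul_mem_schurUnitBall {A : Matrix κ κ ℂ} (hA : A.PosSemidef)
    (hL : diag (Lᴴ * A * L) = 1) (hR : diag (Rᴴ * A * R) = 1) :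
    Lᴴ * A * R ∈ schurUnitBall m n := by
  obtain ⟨C, hC⟩ := exists_eq_conjTranspose_mul_self hA
  have hfactor : Lᴴ * A * R = (C * L)ᴴ * (C * R) := by
    simp only [hC, conjTranspose_mul, Matrix.mul_assoc]
  rw [hfactor]
  exact schurNorm_conjTranspose_mul_le_one (hasContractiveColumns_mul_of_diag_eq_one hC hL)
    (hasContractiveColumns_mul_of_diag_eq_one hC hR)

lemma diag_conjTranspose_mul_self_eq_one {ι : Type*} {A : Matrix κ ι ℂ}
    (hA : ∀ i, ‖toLp 2 (A.col i)‖ = 1) : diag (Aᴴ * A) = 1 := by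
  ext i
  simp [conjTranspose_mul_self_apply_eq_norm_sq, hA]

lemma conjTranspose_mul_mul_eq_zero_of_isHermitian
    (hext : Lᴴ * R ∈ (schurUnitBall m n).extremePoints ℝ)
    (hL : ∀ i, ‖toLp 2 (L.col i)‖ = 1) (hR : ∀ j, ‖toLp 2 (R.col j)‖ = 1)
    {Y : Matrix κ κ ℂ} (hY : Y.IsHermitian) (hYL : diag (Lᴴ * Y * L) = 0)
    (hYR : diag (Rᴴ * Y * R) = 0) : Lᴴ * Y * R = 0 := by
  classical
  obtain ⟨t, ht, hadd, hsub⟩ := exists_posSemidef_one_add_smul_and_one_sub_smul hY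
  have hL1 := diag_conjTranspose_mul_self_eq_one hL
  have hR1 := diag_conjTranspose_mul_self_eq_one hR
  have hmem_add : Lᴴ * R + t • (Lᴴ * Y * R) ∈ schurUnitBall m n := by
    simpa [Matrix.mul_add, Matrix.add_mul] using conjTranspose_mul_mul_mem_schurUnitBall hadd
      (L := L) (R := R) (by simp [Matrix.mul_add, Matrix.add_mul, hL1, hYL])
      (by simp [Matrix.mul_add, Matrix.add_mul, hR1, hYR])
  have hmem_sub : Lᴴ * R - t • (Lᴴ * Y * R) ∈ schurUnitBall m n := by
    simpa [Matrix.mul_sub, Matrix.sub_mul] using conjTranspose_mul_mul_mem_schurUnitBall hsub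
      (L := L) (R := R) (by simp [Matrix.mul_sub, Matrix.sub_mul, hL1, hYL])
      (by simp [Matrix.mul_sub, Matrix.sub_mul, hR1, hYR])
  exact (smul_eq_zero.1 (eq_zero_of_add_mem_of_sub_mem hext hmem_add hmem_sub)).resolve_left ht

lemma diag_conjTranspose_mul_conjTranspose_mul_eq_zero {ι : Type*} {A : Matrix κ ι ℂ}
    {Y : Matrix κ κ ℂ} (h : diag (Aᴴ * Y * A) = 0) : diag (Aᴴ * Yᴴ * A) = 0 := by
  have hstar : Aᴴ * Yᴴ * A = (Aᴴ * Y * A)ᴴ := by simp [Matrix.mul_assoc]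
  rw [hstar, diag_conjTranspose, h, star_zero]

open scoped ComplexStarModule in
theorem conjTranspose_mul_mul_eq_zero (hext : Lᴴ * R ∈ (schurUnitBall m n).extremePoints ℝ)
    (hL : ∀ i, ‖toLp 2 (L.col i)‖ = 1) (hR : ∀ j, ‖toLp 2 (R.col j)‖ = 1)
    {Y : Matrix κ κ ℂ} (hYL : diag (Lᴴ * Y * L) = 0) (hYR : diag (Rᴴ * Y * R) = 0) :
    Lᴴ * Y * R = 0 := by
  have hYL' := diag_conjTranspose_mul_conjTranspose_mul_eq_zero hYL
  have hYR' := diag_conjTranspose_mul_conjTranspose_mul_eq_zero hYR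
  have hre : Lᴴ * (ℜ Y : Matrix κ κ ℂ) * R = 0 :=
    conjTranspose_mul_mul_eq_zero_of_isHermitian hext hL hR (ℜ Y).2
      (by simp [realPart_apply_coe, star_eq_conjTranspose, Matrix.mul_add, Matrix.add_mul, *])
      (by simp [realPart_apply_coe, star_eq_conjTranspose, Matrix.mul_add, Matrix.add_mul, *])
  have him : Lᴴ * (ℑ Y : Matrix κ κ ℂ) * R = 0 :=
    conjTranspose_mul_mul_eq_zero_of_isHermitian hext hL hR (ℑ Y).2
      (by simp [imaginaryPart_apply_coe, star_eq_conjTranspose, Matrix.mul_sub, Matrix.sub_mul, *])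
      (by simp [imaginaryPart_apply_coe, star_eq_conjTranspose, Matrix.mul_sub, Matrix.sub_mul, *])
  rw [← realPart_add_I_smul_imaginaryPart Y, Matrix.mul_add, Matrix.add_mul, hre, Matrix.mul_smul,
    Matrix.smul_mul, him, smul_zero, add_zero]

lemma rank_left_eq_card_of_rank_mul_eq_card (h : (Lᴴ * R).rank = Fintype.card κ) :
    L.rank = Fintype.card κ :=
  le_antisymm L.rank_le_card_height
    (h.symm.trans_le ((rank_mul_le_left _ _).trans_eq (rank_conjTranspose L)))

lemma rank_right_eq_card_of_rank_mul_eq_card (h : (Lᴴ * R).rank = Fintype.card κ) :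
    R.rank = Fintype.card κ :=
  le_antisymm R.rank_le_card_height (h.symm.trans_le (rank_mul_le_right _ _))

theorem eq_zero_of_diag_conjTranspose_mul_mul_eq_zero
    (hext : Lᴴ * R ∈ (schurUnitBall m n).extremePoints ℝ)
    (hrank : (Lᴴ * R).rank = Fintype.card κ)
    (hL : ∀ i, ‖toLp 2 (L.col i)‖ = 1) (hR : ∀ j, ‖toLp 2 (R.col j)‖ = 1)
    {Y : Matrix κ κ ℂ} (hYL : diag (Lᴴ * Y * L) = 0) (hYR : diag (Rᴴ * Y * R) = 0) : Y = 0 := by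
  classical
  have hL_unit := isUnit_mul_conjTranspose_self_of_rank_eq_card
    (rank_left_eq_card_of_rank_mul_eq_card hrank)
  have hR_unit := isUnit_mul_conjTranspose_self_of_rank_eq_card
    (rank_right_eq_card_of_rank_mul_eq_card hrank)
  have hsandwich : L * Lᴴ * (Y * (R * Rᴴ)) = 0 := by
    calc L * Lᴴ * (Y * (R * Rᴴ)) = L * (Lᴴ * Y * R) * Rᴴ := by simp only [Matrix.mul_assoc]
      _ = 0 := by
        rw [conjTranspose_mul_mul_eq_zero hext hL hR hYL hYR, Matrix.mul_zero, Matrix.zero_mul]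
  exact hR_unit.mul_left_eq_zero.1 (hL_unit.mul_right_eq_zero.1 hsandwich)

theorem card_sq_le_add (hext : Lᴴ * R ∈ (schurUnitBall m n).extremePoints ℝ)
    (hrank : (Lᴴ * R).rank = Fintype.card κ)
    (hL : ∀ i, ‖toLp 2 (L.col i)‖ = 1) (hR : ∀ j, ‖toLp 2 (R.col j)‖ = 1) :
    Fintype.card κ ^ 2 ≤ m + n := by
  let diagCompression {k : ℕ} (A : Matrix κ (Fin k) ℂ) : Matrix κ κ ℂ →ₗ[ℂ] Fin k → ℂ :=
    diagLinearMap _ ℂ ℂ ∘ₗ mulRightLinearMap _ ℂ A ∘ₗ mulLeftLinearMap _ ℂ Aᴴ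
  have hinj : Function.Injective ((diagCompression L).prod (diagCompression R)) :=
    (injective_iff_map_eq_zero _).2 fun Y hY =>
      eq_zero_of_diag_conjTranspose_mul_mul_eq_zero hext hrank hL hR
        (congrArg Prod.fst hY) (congrArg Prod.snd hY)
  simpa [Module.finrank_matrix, sq] using LinearMap.finrank_le_finrank_of_injective hinj

end ExtremePoints

section Polar

variable {𝕜 : Type*} [RCLike 𝕜] {κ ι : Type*} [Fintype κ] [DecidableEq κ] [Fintype ι]
  {ι' : Type*} {U : Matrix κ ι 𝕜}

open scoped MatrixOrder in
theorem exists_coisometry_conjTranspose_mul_posSemidef {A : Matrix κ ι 𝕜}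
    (hA : IsUnit (A * Aᴴ)) :
    ∃ U : Matrix κ ι 𝕜, U * Uᴴ = 1 ∧ (Uᴴ * A).PosSemidef := by
  set S := CFC.sqrt (A * Aᴴ)⁻¹
  have hS_pos : S.PosSemidef := nonneg_iff_posSemidef.1 (CFC.sqrt_nonneg _)
  have hSS : S * S = (A * Aᴴ)⁻¹ := CFC.sqrt_mul_sqrt_self _
    (nonneg_iff_posSemidef.2 (posSemidef_self_mul_conjTranspose A).inv)
  have hU : (S * A)ᴴ = Aᴴ * S := by rw [conjTranspose_mul, hS_pos.isHermitian.eq]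
  refine ⟨S * A, ?_, hU ▸ hS_pos.conjTranspose_mul_mul_same A⟩
  rw [hU, Matrix.mul_assoc, mul_eq_one_comm, ← Matrix.mul_assoc, Matrix.mul_assoc, hSS,
    mul_nonsing_inv _ ((isUnit_iff_isUnit_det _).1 hA)]

lemma mul_conjTranspose_mul_of_coisometry (hU : U * Uᴴ = 1) (A : Matrix κ ι' 𝕜) :
    U * (Uᴴ * A) = A := by
  rw [← Matrix.mul_assoc, hU, Matrix.one_mul]

lemma conjTranspose_mul_self_of_coisometry (hU : U * Uᴴ = 1) (A : Matrix κ ι' 𝕜) :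
    (Uᴴ * A)ᴴ * (Uᴴ * A) = Aᴴ * A := by
  rw [conjTranspose_mul, conjTranspose_conjTranspose, Matrix.mul_assoc,
    mul_conjTranspose_mul_of_coisometry hU]

lemma rank_conjTranspose_mul_of_coisometry [Fintype ι'] (hU : U * Uᴴ = 1)
    (A : Matrix κ ι' 𝕜) : (Uᴴ * A).rank = A.rank := by
  rw [← rank_conjTranspose_mul_self, conjTranspose_mul_self_of_coisometry hU,
    rank_conjTranspose_mul_self]

lemma norm_toEuclideanLin_conjTranspose_of_coisometry (hU : U * Uᴴ = 1)
    (x : EuclideanSpace 𝕜 κ) : ‖toEuclideanLin Uᴴ x‖ = ‖x‖ := by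
  classical
  have hinner : inner 𝕜 (toEuclideanLin Uᴴ x) (toEuclideanLin Uᴴ x) = inner 𝕜 x x := by
    rw [toEuclideanLin_conjTranspose_eq_adjoint, LinearMap.adjoint_inner_left,
      ← toEuclideanLin_conjTranspose_eq_adjoint, ← LinearMap.comp_apply, ← toLpLin_mul, hU,
      toLpLin_one, LinearMap.id_apply]
  rw [norm_eq_sqrt_re_inner (𝕜 := 𝕜), hinner, ← norm_eq_sqrt_re_inner]

end Polar

section PartialIsometry

variable {m n r : ℕ}

lemma matRange_mul_of_isUnit_mul_conjTranspose {A : Matrix (Fin r) (Fin m) ℂ}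
    (hA : IsUnit (A * Aᴴ)) (B : Matrix (Fin n) (Fin r) ℂ) : matRange (B * A) = matRange B := by
  refine le_antisymm ?_ ?_
  · rw [matRange, toLpLin_mul _ 2]
    exact LinearMap.range_comp_le_range _ _
  · have hB : B = B * A * (Aᴴ * (A * Aᴴ)⁻¹) := by
      rw [Matrix.mul_assoc B, ← Matrix.mul_assoc A,
        mul_nonsing_inv _ ((isUnit_iff_isUnit_det _).1 hA), Matrix.mul_one]
    conv_lhs => rw [hB, matRange, toLpLin_mul _ 2]
    exact LinearMap.range_comp_le_range _ _

theorem isPartialIsometryFromOnto_conjTranspose_mul {U : Matrix (Fin r) (Fin m) ℂ}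
    {W : Matrix (Fin r) (Fin n) ℂ} (hU : U * Uᴴ = 1) (hW : W * Wᴴ = 1) :
    IsPartialIsometryFromOnto (Uᴴ * W) (matRange Wᴴ) (matRange Uᴴ) := by
  have hcomp : toEuclideanLin (Uᴴ * W) ∘ₗ toEuclideanLin Wᴴ = toEuclideanLin Uᴴ := by
    rw [← toLpLin_mul, Matrix.mul_assoc, hW, Matrix.mul_one]
  refine ⟨?_, fun x hx => ?_, ?_⟩
  · rintro _ ⟨x, rfl⟩
    rw [← LinearMap.comp_apply, hcomp, norm_toEuclideanLin_conjTranspose_of_coisometry hU,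
      norm_toEuclideanLin_conjTranspose_of_coisometry hW]
  · rw [matRange, LinearMap.orthogonal_range, ← toEuclideanLin_conjTranspose_eq_adjoint,
      conjTranspose_conjTranspose, LinearMap.mem_ker] at hx
    rw [toLpLin_mul _ 2, LinearMap.comp_apply, hx, map_zero]
  · rw [matRange, ← LinearMap.range_comp, hcomp, matRange]

lemma sq_conjTranspose_mul_mem_unitDiagPos {A U : Matrix (Fin r) (Fin m) ℂ} (hU : U * Uᴴ = 1)
    (hUA : (Uᴴ * A).PosSemidef) (hA : ∀ i, ‖toLp 2 (A.col i)‖ = 1) :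
    (Uᴴ * A) ^ 2 ∈ unitDiagPos m := by
  have hsq : (Uᴴ * A) ^ 2 = Aᴴ * A := by
    rw [← conjTranspose_mul_self_of_coisometry hU, hUA.isHermitian.eq, sq]
  rw [hsq]
  exact ⟨posSemidef_conjTranspose_mul_self A,
    congr_fun (diag_conjTranspose_mul_self_eq_one hA)⟩

theorem exists_eq_mul_partialIsometry_mul {L : Matrix (Fin r) (Fin m) ℂ}
    {R : Matrix (Fin r) (Fin n) ℂ} (hrank : (Lᴴ * R).rank = r)
    (hL : ∀ i, ‖toLp 2 (L.col i)‖ = 1) (hR : ∀ j, ‖toLp 2 (R.col j)‖ = 1) :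
    ∃ (F : Matrix (Fin m) (Fin m) ℂ) (V : Matrix (Fin m) (Fin n) ℂ)
      (G : Matrix (Fin n) (Fin n) ℂ), Lᴴ * R = F * V * G ∧
        F.PosSemidef ∧ F.rank = r ∧ F ^ 2 ∈ unitDiagPos m ∧
        G.PosSemidef ∧ G.rank = r ∧ G ^ 2 ∈ unitDiagPos n ∧
        IsPartialIsometryFromOnto V (matRange G) (matRange F) := by
  have hcard : (Lᴴ * R).rank = Fintype.card (Fin r) := by simpa using hrank
  have hL_rank := rank_left_eq_card_of_rank_mul_eq_card hcard
  have hR_rank := rank_right_eq_card_of_rank_mul_eq_card hcard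
  have hL_unit := isUnit_mul_conjTranspose_self_of_rank_eq_card hL_rank
  have hR_unit := isUnit_mul_conjTranspose_self_of_rank_eq_card hR_rank
  obtain ⟨U, hU, hF⟩ := exists_coisometry_conjTranspose_mul_posSemidef hL_unit
  obtain ⟨W, hW, hG⟩ := exists_coisometry_conjTranspose_mul_posSemidef hR_unit
  refine ⟨Uᴴ * L, Uᴴ * W, Wᴴ * R, ?_, hF, ?_, sq_conjTranspose_mul_mem_unitDiagPos hU hF hL,
    hG, ?_, sq_conjTranspose_mul_mem_unitDiagPos hW hG hR, ?_⟩
  · calc Lᴴ * R = (Uᴴ * L)ᴴ * (Uᴴ * W) * (Wᴴ * R) := by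
          rw [conjTranspose_mul, conjTranspose_conjTranspose, Matrix.mul_assoc Lᴴ,
            mul_conjTranspose_mul_of_coisometry hU, Matrix.mul_assoc,
            mul_conjTranspose_mul_of_coisometry hW]
      _ = Uᴴ * L * (Uᴴ * W) * (Wᴴ * R) := by rw [hF.isHermitian.eq]
  · rw [rank_conjTranspose_mul_of_coisometry hU, hL_rank, Fintype.card_fin]
  · rw [rank_conjTranspose_mul_of_coisometry hW, hR_rank, Fintype.card_fin]
  · rw [matRange_mul_of_isUnit_mul_conjTranspose hL_unit,
      matRange_mul_of_isUnit_mul_conjTranspose hR_unit]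
    exact isPartialIsometryFromOnto_conjTranspose_mul hU hW

end PartialIsometry

section SchurFactorization

variable {m n r : ℕ} {X : Matrix (Fin m) (Fin n) ℂ} {L : Matrix (Fin r) (Fin m) ℂ}
  {R : Matrix (Fin r) (Fin n) ℂ}

lemma hasContractiveColumns_iff_colNorm_le_one : HasContractiveColumns L ↔ colNorm L ≤ 1 :=
  ⟨fun h => Real.iSup_le h zero_le_one,
    fun h i => (Finite.le_ciSup (fun j => ‖colVec L j‖) i).trans h⟩

lemma vectorFunctional_colVec (L : Matrix (Fin r) (Fin m) ℂ) (Y : Matrix (Fin r) (Fin r) ℂ)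
    (i : Fin m) : vectorFunctional (colVec L i) Y = (Lᴴ * Y * L) i i := by
  rw [Matrix.mul_assoc, conjTranspose_mul_apply_eq_inner]
  rfl

theorem norm_colVec_eq_one (hext : X ∈ (schurUnitBall m n).extremePoints ℝ)
    (hnorm : schurNorm X = 1) (h : IsSchurFactorization X L R) :
    (∀ i, ‖colVec L i‖ = 1) ∧ ∀ j, ‖colVec R j‖ = 1 := by
  have hL : HasContractiveColumns L :=
    hasContractiveColumns_iff_colNorm_le_one.2 (by simp [h.colNorm_left, hnorm])
  have hR : HasContractiveColumns R :=
    hasContractiveColumns_iff_colNorm_le_one.2 (by simp [h.colNorm_right, hnorm])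
  have hX := ne_zero_of_schurNorm_eq_one hnorm
  exact ⟨norm_col_left_eq_one hext hX hL hR h.eq_mul, norm_col_right_eq_one hext hX hL hR h.eq_mul⟩

theorem isFullSet_range_colVec (hext : Lᴴ * R ∈ (schurUnitBall m n).extremePoints ℝ)
    (hrank : (Lᴴ * R).rank = r) (hL : ∀ i, ‖colVec L i‖ = 1) (hR : ∀ j, ‖colVec R j‖ = 1) :
    IsFullSet (Set.range (colVec L) ∪ Set.range (colVec R)) := by
  refine fun Y _ hY => eq_zero_of_diag_conjTranspose_mul_mul_eq_zero hext (by simpa using hrank)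
    hL hR ?_ ?_
  · ext i
    exact (vectorFunctional_colVec L Y i).symm.trans (hY _ (.inl ⟨i, rfl⟩))
  · ext j
    exact (vectorFunctional_colVec R Y j).symm.trans (hY _ (.inr ⟨j, rfl⟩))

end SchurFactorization

end SchurMult

theorem mainTheorem1 {m n r : ℕ} (X : Matrix (Fin m) (Fin n) ℂ)
    (hext : X ∈ Set.extremePoints ℝ (SchurMult.schurUnitBall m n))
    (hnorm : SchurMult.schurNorm X = 1) (hrank : X.rank = r) :
    (∀ (L : Matrix (Fin r) (Fin m) ℂ) (R : Matrix (Fin r) (Fin n) ℂ),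
      SchurMult.IsSchurFactorization X L R →
        (∀ i, ‖SchurMult.colVec L i‖ = 1) ∧ (∀ j, ‖SchurMult.colVec R j‖ = 1)) ∧
    (∃ (F : Matrix (Fin m) (Fin m) ℂ) (V : Matrix (Fin m) (Fin n) ℂ)
        (G : Matrix (Fin n) (Fin n) ℂ),
      X = F * V * G ∧
      F.PosSemidef ∧ F.rank = r ∧ F ^ 2 ∈ SchurMult.unitDiagPos m ∧
      G.PosSemidef ∧ G.rank = r ∧ G ^ 2 ∈ SchurMult.unitDiagPos n ∧
      SchurMult.IsPartialIsometryFromOnto V (SchurMult.matRange G) (SchurMult.matRange F)) ∧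
    (∀ (L : Matrix (Fin r) (Fin m) ℂ) (R : Matrix (Fin r) (Fin n) ℂ),
      SchurMult.IsSchurFactorization X L R →
        SchurMult.IsFullSet
          (Set.range (SchurMult.colVec L) ∪ Set.range (SchurMult.colVec R))) ∧
    (X.rank : ℝ) ≤ Real.sqrt ((m : ℝ) + (n : ℝ)) := by
  obtain ⟨L, R, hL, hR, rfl⟩ := SchurMult.exists_contractive_factorization_of_rank_eq hnorm.le hrank
  have hX := SchurMult.ne_zero_of_schurNorm_eq_one hnorm
  have hL_unit := SchurMult.norm_col_left_eq_one hext hX hL hR rfl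
  have hR_unit := SchurMult.norm_col_right_eq_one hext hX hL hR rfl
  refine ⟨fun L' R' h => SchurMult.norm_colVec_eq_one hext hnorm h,
    SchurMult.exists_eq_mul_partialIsometry_mul hrank hL_unit hR_unit, fun L' R' h => ?_, ?_⟩
  · obtain ⟨hL', hR'⟩ := SchurMult.norm_colVec_eq_one hext hnorm h
    rw [h.eq_mul] at hext hrank
    exact SchurMult.isFullSet_range_colVec hext hrank hL' hR'
  · have hsq := SchurMult.card_sq_le_add hext (by simpa using hrank) hL_unit hR_unit
    rw [Fintype.card_fin] at hsq
    rw [hrank]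
    exact Real.le_sqrt_of_sq_le (by exact_mod_cast hsq)
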